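/- Let $n\ge 0$, let $Y\in\mathbb{C}^{n\times n}$ be invertible and let $V^0\in\mathbb{C}^n$. For $s\in\mathbb{C}^n$ consider the power flow equations $$\operatorname{diag}(V)\,\overline{Y(V-V^0)}=s\qquad(\ast)$$ in the unknown $V\in\mathbb{C}^n$. Let $(V_\star,s_\star)$ satisfy $(\ast)$, with all entries of $V_\star$ nonzero. Bars denote entrywise complex conjugation, $\|x\|=\max_i|x_i|$ for vectors and $\|A\|=\max_i\sum_j|A_{ij}|$ for matrices. Put $$Z_\star=\operatorname{diag}(\overline{V_\star})^{-1}\,\overline{Y}^{\,-1}\operatorname{diag}(V_\star)^{-1},\qquad J_\star=\begin{pmatrix} I & \overline{Z_\star}\operatorname{diag}(\overline{s_\star})\\ Z_\star\operatorname{diag}(s_\star) & I\end{pmatrix},$$ assume that $J_\star$ is nonsingular, and let $M_\star$ and $N_\star$ be the upper left and upper right $n\times n$ blocks of $J_\star^{-1}$. For $s\in\mathbb{C}^n$ write $\Delta s=s-s_\star$ and $$L(s)=\big\|M_\star\overline{Z_\star}\operatorname{diag}(\overline{\Delta s})+N_\star\operatorname{diag}(Z_\star\Delta s)\big\|+\big\|M_\star\operatorname{diag}(\overline{Z_\star\Delta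 s})+N_\star Z_\star\operatorname{diag}(\Delta s)\big\|.$$ For $r>0$ let $S_r$ be the set of all $s\in\mathbb{C}^n$ with $$\frac1r\big\|M_\star\overline{Z_\star}\,\overline{\Delta s}+N_\star Z_\star\Delta s\big\|+\|J_\star^{-1}\|\,\|Z_\star\operatorname{diag}(s)\|\,r+L(s)\le 1,$$ and let $\mathcal{S}_r=\bigcup_{0<\epsilon\le1}S_{\epsilon r}$. Then: 1. For every $r>0$ and every $s\in\mathcal{S}_r$ there is a solution $V$ of $(\ast)$; if moreover $r<1$, this $V$ can be chosen such that $$\frac{|V_{\star i}|}{1+r}\le|V_i|\le\frac{|V_{\star i}|}{1-r}\qquad\text{for all } i.$$ 2. For every $s\in\mathbb{C}^n$ with $$2\sqrt{\big\|M_\star\overline{Z_\star}\operatorname{diag}(\overline{\Delta s})+N_\star Z_\star\operatorname{diag}(\Delta s)\big\|\,\|J_\star^{-1}\|\,\|Z_\star\operatorname{diag}(s)\|}+L(s)\le1$$ there is a solution $V$ of $(\ast)$. -/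

import Mathlib

open scoped Matrix

noncomputable section

namespace PowerFlow

-- The norm on matrices in this section is the maximal absolute row sum (the operator norm induced
-- by the sup norm); the norm on `Fin n → ℂ` is Mathlib's default, the sup norm `max_i |x_i|`.
attribute [local instance] Matrix.linftyOpNormedAddCommGroup

variable {n : ℕ}

/-- Entrywise complex conjugate of a matrix (no transposition). -/
def conjMat (A : Matrix (Fin n) (Fin n) ℂ) : Matrix (Fin n) (Fin n) ℂ :=
  A.map (starRingEnd ℂ)

/-- `V` solves the power flow equations `diag(V) conj(Y (V - V⁰)) = s`. -/
def IsSolution (Y : Matrix (Fin n) (Fin n) ℂ) (V0 s V : Fin n → ℂ) : Prop :=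
  Matrix.diagonal V *ᵥ star (Y *ᵥ (V - V0)) = s

/-- `Z⋆ = diag(conj V⋆)⁻¹ (conj Y)⁻¹ diag(V⋆)⁻¹`. -/
def Zmat (Y : Matrix (Fin n) (Fin n) ℂ) (Vs : Fin n → ℂ) : Matrix (Fin n) (Fin n) ℂ :=
  (Matrix.diagonal (star Vs))⁻¹ * (conjMat Y)⁻¹ * (Matrix.diagonal Vs)⁻¹

/-- `J⋆ = [[I, conj(Z⋆) diag(conj s⋆)], [Z⋆ diag(s⋆), I]]`. -/
def Jmat (Y : Matrix (Fin n) (Fin n) ℂ) (Vs ss : Fin n → ℂ) :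
    Matrix (Fin n ⊕ Fin n) (Fin n ⊕ Fin n) ℂ :=
  Matrix.fromBlocks 1 (conjMat (Zmat Y Vs) * Matrix.diagonal (star ss))
    (Zmat Y Vs * Matrix.diagonal ss) 1

/-- `M⋆`, the upper left block of `J⋆⁻¹`. -/
def Mmat (Y : Matrix (Fin n) (Fin n) ℂ) (Vs ss : Fin n → ℂ) : Matrix (Fin n) (Fin n) ℂ :=
  ((Jmat Y Vs ss)⁻¹).toBlocks₁₁

/-- `N⋆`, the upper right block of `J⋆⁻¹`. -/
def Nmat (Y : Matrix (Fin n) (Fin n) ℂ) (Vs ss : Fin n → ℂ) : Matrix (Fin n) (Fin n) ℂ :=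
  ((Jmat Y Vs ss)⁻¹).toBlocks₁₂

/-- `‖M⋆ conj(Z⋆) conj(Δs) + N⋆ Z⋆ Δs‖`, the norm of a vector. -/
def shiftVecNorm (Y : Matrix (Fin n) (Fin n) ℂ) (Vs ss Δs : Fin n → ℂ) : ℝ :=
  ‖(Mmat Y Vs ss * conjMat (Zmat Y Vs)) *ᵥ star Δs + (Nmat Y Vs ss * Zmat Y Vs) *ᵥ Δs‖

/-- `‖M⋆ conj(Z⋆) diag(conj Δs) + N⋆ Z⋆ diag(Δs)‖`, the norm of a matrix. -/
def shiftMatNorm (Y : Matrix (Fin n) (Fin n) ℂ) (Vs ss Δs : Fin n → ℂ) : ℝ :=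
  ‖Mmat Y Vs ss * conjMat (Zmat Y Vs) * Matrix.diagonal (star Δs)
    + Nmat Y Vs ss * Zmat Y Vs * Matrix.diagonal Δs‖

/-- `‖J⋆⁻¹‖ ‖Z⋆ diag(s)‖`. -/
def quadCoeff (Y : Matrix (Fin n) (Fin n) ℂ) (Vs ss s : Fin n → ℂ) : ℝ :=
  ‖(Jmat Y Vs ss)⁻¹‖ * ‖Zmat Y Vs * Matrix.diagonal s‖

/-- `‖M⋆ conj(Z⋆) diag(conj Δs) + N⋆ diag(Z⋆ Δs)‖`. -/
def linNormA (Y : Matrix (Fin n) (Fin n) ℂ) (Vs ss Δs : Fin n → ℂ) : ℝ :=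
  ‖Mmat Y Vs ss * conjMat (Zmat Y Vs) * Matrix.diagonal (star Δs)
    + Nmat Y Vs ss * Matrix.diagonal (Zmat Y Vs *ᵥ Δs)‖

/-- `‖M⋆ diag(conj(Z⋆ Δs)) + N⋆ Z⋆ diag(Δs)‖`. -/
def linNormB (Y : Matrix (Fin n) (Fin n) ℂ) (Vs ss Δs : Fin n → ℂ) : ℝ :=
  ‖Mmat Y Vs ss * Matrix.diagonal (star (Zmat Y Vs *ᵥ Δs))
    + Nmat Y Vs ss * Zmat Y Vs * Matrix.diagonal Δs‖

/-- The certified set `S_r`, with `Δs = s - s⋆`. -/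
def certSet (Y : Matrix (Fin n) (Fin n) ℂ) (Vs ss : Fin n → ℂ) (r : ℝ) : Set (Fin n → ℂ) :=
  {s | 1 / r * shiftVecNorm Y Vs ss (s - ss) + quadCoeff Y Vs ss s * r
      + linNormA Y Vs ss (s - ss) + linNormB Y Vs ss (s - ss) ≤ 1}

/-- The union `𝒮_r` of the sets `S_{εr}` over `0 < ε ≤ 1`. -/
def certUnion (Y : Matrix (Fin n) (Fin n) ℂ) (Vs ss : Fin n → ℂ) (r : ℝ) : Set (Fin n → ℂ) :=
  ⋃ ε ∈ Set.Ioc (0 : ℝ) 1, certSet Y Vs ss (ε * r)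

/-- The certificate that does not involve `r`, with `Δs = s - s⋆`. -/
def RadiusFreeCondition (Y : Matrix (Fin n) (Fin n) ℂ) (Vs ss s : Fin n → ℂ) : Prop :=
  2 * Real.sqrt (shiftMatNorm Y Vs ss (s - ss) * quadCoeff Y Vs ss s)
    + linNormA Y Vs ss (s - ss) + linNormB Y Vs ss (s - ss) ≤ 1

/-- The voltage bounds `|V⋆ᵢ| / (1 + r) ≤ |Vᵢ| ≤ |V⋆ᵢ| / (1 - r)` (meaningful for `0 < r < 1`). -/
def VoltageBounds (Vs : Fin n → ℂ) (r : ℝ) (V : Fin n → ℂ) : Prop :=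
  ∀ i, ‖Vs i‖ / (1 + r) ≤ ‖V i‖ ∧ ‖V i‖ ≤ ‖Vs i‖ / (1 - r)

end PowerFlow

end

open scoped Matrix

/-! Write `V = V⋆ / (1 + x)`. The power flow equations become `conj x + Z⋆ diag(s⋆) x = g(x)`, with
`g` the quadratic `residual`. Together with its conjugate this reads `J⋆ (x, conj x) = (conj g, g)`,
so solutions arise from fixed points of `T(x) = M⋆ conj(g(x)) + N⋆ g(x)`.

Let `c`, `l`, `q` bound the constant, linear and quadratic terms of `T`. On the ball of radius `ρ`,
`T` is bounded by `c + l ρ + q ρ²` and has Lipschitz constant `l + 2 q ρ`. The certificates give a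
`ρ` for which the first is at most `ρ` and the second at most 1: a root-free choice left of the
parabola's vertex for part 1, `ρ = √(c / q)` for part 2. Nonexpansiveness on a compact ball then
suffices for a fixed point (`exists_isSolution_of_radius`). -/

/-- A nonexpansive self-map of a closed ball of a proper normed space has a fixed point. -/
theorem exists_fixedPoint_of_nonexpansive_closedBall {E : Type*} [NormedAddCommGroup E]
    [NormedSpace ℝ E] [ProperSpace E] {T : E → E} {ρ : ℝ} (hρ : 0 ≤ ρ)
    (hmaps : Set.MapsTo T (Metric.closedBall 0 ρ) (Metric.closedBall 0 ρ))
    (hlip : LipschitzOnWith 1 T (Metric.closedBall 0 ρ)) :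
    ∃ x ∈ Metric.closedBall (0 : E) ρ, T x = x := by
  obtain ⟨x, hx, hmin⟩ := (isCompact_closedBall (0 : E) ρ).exists_isMinOn
    ⟨0, Metric.mem_closedBall_self hρ⟩
    ((hlip.continuousOn.sub continuousOn_id).norm)
  refine ⟨x, hx, ?_⟩
  -- The contraction `t • T` has a fixed point `y`, whose displacement under `T` is `(1 - t) • T y`.
  -- As `x` minimizes the displacement, letting `t → 1` makes it vanish.
  have key : ∀ t : ℝ, 0 ≤ t → t < 1 → ‖T x - x‖ ≤ (1 - t) * ρ := by
    intro t ht0 ht1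
    have hmt : Set.MapsTo (fun y => t • T y) (Metric.closedBall (0 : E) ρ)
        (Metric.closedBall 0 ρ) := by
      intro y hy
      have := hmaps hy
      simp only [mem_closedBall_zero_iff, norm_smul, Real.norm_eq_abs, abs_of_nonneg ht0]
        at this ⊢
      nlinarith [norm_nonneg (T y)]
    have hc : ContractingWith ⟨t, ht0⟩ (hmt.restrict _ _ _) := by
      refine ⟨by exact_mod_cast ht1, LipschitzWith.of_dist_le_mul fun y z => ?_⟩
      have h := hlip.dist_le_mul y.1 y.2 z.1 z.2
      simp only [NNReal.coe_one, one_mul] at h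
      change dist (t • T y.1) (t • T z.1) ≤ t * dist y.1 z.1
      rw [dist_smul₀, Real.norm_eq_abs, abs_of_nonneg ht0]
      exact mul_le_mul_of_nonneg_left h ht0
    obtain ⟨y, hy, hfix, -⟩ := hc.exists_fixedPoint' Metric.isClosed_closedBall.isComplete
      hmt (Metric.mem_closedBall_self hρ) (edist_ne_top _ _)
    have hfix : t • T y = y := hfix
    have h1 : ‖T x - x‖ ≤ ‖T y - y‖ := hmin hy
    have h2 : T y - y = (1 - t) • T y := by
      rw [sub_smul, one_smul, hfix]
    rw [h2, norm_smul, Real.norm_eq_abs, abs_of_nonneg (by linarith)] at h1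
    exact h1.trans (mul_le_mul_of_nonneg_left (mem_closedBall_zero_iff.1 (hmaps hy))
      (by linarith))
  have hlim : Filter.Tendsto (fun t : ℝ => (1 - t) * ρ) (nhdsWithin 1 (Set.Iio 1))
      (nhds 0) := by
    have : Continuous fun t : ℝ => (1 - t) * ρ := by fun_prop
    simpa using (this.tendsto 1).mono_left nhdsWithin_le_nhds
  have h0 : ‖T x - x‖ ≤ 0 := by
    refine ge_of_tendsto hlim ?_
    filter_upwards [Ioo_mem_nhdsLT (show (0 : ℝ) < 1 by norm_num)] with t ht
    exact key t ht.1.le ht.2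
  exact sub_eq_zero.1 (norm_le_zero_iff.1 h0)

/-- If `c + q r² + l r ≤ r` then some radius `ρ ≤ r` satisfies the same inequality and lies to the
left of the vertex of the parabola `c + q ρ² - (1 - l) ρ`. -/
theorem exists_radius_le_vertex {c q l r : ℝ} (hc : 0 ≤ c) (hq : 0 ≤ q) (hr : 0 < r)
    (h : 1 / r * c + q * r + l ≤ 1) :
    ∃ ρ, 0 ≤ ρ ∧ ρ ≤ r ∧ c + q * ρ ^ 2 + l * ρ ≤ ρ ∧ l + 2 * q * ρ ≤ 1 := by
  have hcr : 0 ≤ 1 / r * c := by positivity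
  have h' : c + q * r ^ 2 + l * r ≤ r := by
    have := mul_le_mul_of_nonneg_right h hr.le
    have e : (1 / r * c + q * r + l) * r = c + q * r ^ 2 + l * r := by field_simp
    linarith
  by_cases hv : l + 2 * q * r ≤ 1
  · exact ⟨r, hr.le, le_rfl, h', hv⟩
  · push Not at hv
    have hq0 : 0 < q := by
      rcases hq.eq_or_lt with rfl | hq0
      · simp only [zero_mul, mul_zero, add_zero] at h hv
        linarith
      · exact hq0
    have hl : l ≤ 1 := by nlinarith
    -- This is the vertex, where the parabola is lower than at `r` by `q (r - ρ)²`.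
    obtain ⟨ρ, hρ⟩ : ∃ ρ, 2 * q * ρ = 1 - l := ⟨(1 - l) / (2 * q), by field_simp⟩
    refine ⟨ρ, ?_, ?_, ?_, by linarith⟩
    · by_contra! hneg
      nlinarith
    · by_contra! hneg
      nlinarith
    · nlinarith [mul_nonneg hq (sq_nonneg (r - ρ))]

/-- The radius attached to the discriminant condition `2 √(c q) + l ≤ 1`. -/
theorem exists_radius_of_discriminant {c q l : ℝ} (hc : 0 ≤ c) (hq : 0 < q)
    (h : 2 * Real.sqrt (c * q) + l ≤ 1) :
    ∃ ρ, 0 ≤ ρ ∧ c + q * ρ ^ 2 + l * ρ ≤ ρ ∧ l + 2 * q * ρ ≤ 1 := by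
  have hs : Real.sqrt (c * q) ^ 2 = c * q := Real.sq_sqrt (by positivity)
  have hs0 := Real.sqrt_nonneg (c * q)
  set w := Real.sqrt (c * q)
  -- Here `ρ = √(c / q)` balances `c` and `q ρ²`: both equal `w ρ`, so both conclusions reduce to `2
  -- w + l ≤ 1`.
  obtain ⟨ρ, hρ⟩ : ∃ ρ, q * ρ = w := ⟨w / q, by field_simp⟩
  have hρ0 : 0 ≤ ρ := by
    by_contra! hneg
    nlinarith
  have hcρ : c = w * ρ := by
    have : q * c = q * (w * ρ) := by linear_combination -hs - w * hρ
    exact mul_left_cancel₀ hq.ne' this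
  refine ⟨ρ, hρ0, ?_, by linarith⟩
  have e : q * ρ ^ 2 = w * ρ := by rw [← hρ]; ring
  nlinarith

namespace PowerFlow

attribute [local instance] Matrix.linftyOpNormedAddCommGroup

/-! ### Conjugation, diagonal matrices and the change of variables. -/

theorem diagonal_mulVec_eq_mul {n : ℕ} (v x : Fin n → ℂ) : Matrix.diagonal v *ᵥ x = v * x := by
  ext i
  simp [Matrix.mulVec_diagonal]

theorem star_mulVec_eq_conjMat {n : ℕ} (A : Matrix (Fin n) (Fin n) ℂ) (v : Fin n → ℂ) :
    star (A *ᵥ v) = conjMat A *ᵥ star v := by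
  ext i
  simp [Matrix.mulVec, dotProduct, conjMat]

theorem conjMat_conjMat {n : ℕ} (A : Matrix (Fin n) (Fin n) ℂ) : conjMat (conjMat A) = A := by
  ext i j
  simp [conjMat]

theorem isUnit_det_conjMat {n : ℕ} {A : Matrix (Fin n) (Fin n) ℂ} (hA : IsUnit A.det) :
    IsUnit (conjMat A).det := by
  have : (conjMat A).det = starRingEnd ℂ A.det := by
    rw [RingHom.map_det]; rfl
  rw [this]
  exact hA.map _

theorem isUnit_det_diagonal {n : ℕ} {v : Fin n → ℂ} (hv : ∀ i, v i ≠ 0) :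
    IsUnit (Matrix.diagonal v).det := by
  rw [Matrix.det_diagonal, isUnit_iff_ne_zero]
  exact Finset.prod_ne_zero_iff.2 fun i _ => hv i

theorem diagonal_inv_mulVec {n : ℕ} {v : Fin n → ℂ} (hv : ∀ i, v i ≠ 0) (x : Fin n → ℂ) :
    (Matrix.diagonal v)⁻¹ *ᵥ x = x / v := by
  have h : Matrix.diagonal v *ᵥ (x / v) = x := by
    rw [diagonal_mulVec_eq_mul]
    ext i
    simp [mul_div_cancel₀, hv i]
  conv_lhs => rw [← h]
  rw [Matrix.mulVec_mulVec, Matrix.nonsing_inv_mul _ (isUnit_det_diagonal hv), Matrix.one_mulVec]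

theorem conjMat_mulVec_Zmat {n : ℕ} {Y : Matrix (Fin n) (Fin n) ℂ} {Vs : Fin n → ℂ}
    (hY : IsUnit Y.det) (hVs : ∀ i, Vs i ≠ 0) (u : Fin n → ℂ) :
    conjMat Y *ᵥ (star Vs * (Zmat Y Vs *ᵥ u)) = u / Vs := by
  have hst : ∀ i, star Vs i ≠ 0 := fun i => by simpa using hVs i
  rw [← diagonal_mulVec_eq_mul, Zmat, ← Matrix.mulVec_mulVec, ← Matrix.mulVec_mulVec,
    diagonal_inv_mulVec hVs, Matrix.mulVec_mulVec _ (Matrix.diagonal (star Vs)),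
    Matrix.mul_nonsing_inv _ (isUnit_det_diagonal hst), Matrix.one_mulVec, Matrix.mulVec_mulVec,
    Matrix.mul_nonsing_inv _ (isUnit_det_conjMat hY), Matrix.one_mulVec]

/-- In the coordinates `V = V⋆ / (1 + x)` the power flow equations become
`(1 + conj x) (1 + Z⋆ (diag(s) (1 + x) - s⋆)) = 1`. -/
theorem isSolution_div_of_eq_one {n : ℕ} {Y : Matrix (Fin n) (Fin n) ℂ} {V0 Vs ss s x : Fin n → ℂ}
    (hY : IsUnit Y.det) (hVs : ∀ i, Vs i ≠ 0) (hsol : IsSolution Y V0 ss Vs)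
    (hx : (1 + star x) * (1 + Zmat Y Vs *ᵥ (s * (1 + x) - ss)) = 1) :
    (∀ i, 1 + x i ≠ 0) ∧ IsSolution Y V0 s (Vs / (1 + x)) := by
  have hne : ∀ i, 1 + x i ≠ 0 := by
    intro i h
    have h1 := congrFun hx i
    have h2 : (1 + star x) i = 0 := by
      have := congrArg star h
      simpa using this
    simp [Pi.mul_apply, h2] at h1
  refine ⟨hne, ?_⟩
  unfold IsSolution at hsol ⊢
  rw [diagonal_mulVec_eq_mul, star_mulVec_eq_conjMat] at hsol ⊢
  set w := Zmat Y Vs *ᵥ (s * (1 + x) - ss)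
  -- By `hx`, `1 + w` is the inverse of `1 + conj x`, so `conj V = conj V⋆ (1 + w)`.
  have hV : star (Vs / (1 + x) - V0) = star Vs * w + star (Vs - V0) := by
    ext i
    have h1 := congrFun hx i
    have h2 : 1 + starRingEnd ℂ (x i) ≠ 0 := by
      intro h
      apply hne i
      simpa using congrArg (starRingEnd ℂ) h
    simp only [Pi.mul_apply, Pi.add_apply, Pi.one_apply, Pi.star_apply, RCLike.star_def,
      Pi.sub_apply, Pi.div_apply, map_sub, map_div₀, map_add, map_one] at h1 ⊢
    field_simp
    linear_combination (-starRingEnd ℂ (Vs i)) * h1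
  rw [hV, Matrix.mulVec_add, conjMat_mulVec_Zmat hY hVs]
  ext i
  have h1 := congrFun hsol i
  have h2 := hne i
  have h3 := hVs i
  simp only [Pi.mul_apply, Pi.add_apply, Pi.one_apply, Pi.sub_apply, Pi.div_apply] at h1 ⊢
  field_simp
  linear_combination h1

/-! ### Norm estimates for the quadratic term and for block rows. -/

theorem norm_mul_mulVec_sub_le {n : ℕ} (K : Matrix (Fin n) (Fin n) ℂ) {ρ : ℝ}
    {a b x y : Fin n → ℂ} (ha : ‖a‖ ≤ ρ) (hy : ‖y‖ ≤ ρ) (hab : ‖a - b‖ ≤ ‖x - y‖) :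
    ‖a * (K *ᵥ x) - b * (K *ᵥ y)‖ ≤ 2 * ‖K‖ * ρ * ‖x - y‖ := by
  have e : a * (K *ᵥ x) - b * (K *ᵥ y) = a * (K *ᵥ (x - y)) + (a - b) * (K *ᵥ y) := by
    rw [Matrix.mulVec_sub]; ring
  have hK := norm_nonneg K
  have hρ : 0 ≤ ρ := (norm_nonneg a).trans ha
  calc ‖a * (K *ᵥ x) - b * (K *ᵥ y)‖ ≤ ‖a‖ * ‖K *ᵥ (x - y)‖ + ‖a - b‖ * ‖K *ᵥ y‖ := by
        rw [e]
        exact (norm_add_le _ _).trans (add_le_add (norm_mul_le _ _) (norm_mul_le _ _))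
    _ ≤ ρ * (‖K‖ * ‖x - y‖) + ‖x - y‖ * (‖K‖ * ρ) := by
        gcongr
        · exact Matrix.linfty_opNorm_mulVec _ _
        · exact (Matrix.linfty_opNorm_mulVec _ _).trans (by gcongr)
    _ = _ := by ring

/-- The left side is the upper half of `A` applied to the stacked vector `(u, v)`, whose sup norm is
at most `c`. This is the source of the factor `‖J⋆⁻¹‖`. -/
theorem norm_toBlocks_mulVec_add_le {n : ℕ} (A : Matrix (Fin n ⊕ Fin n) (Fin n ⊕ Fin n) ℂ) {c : ℝ}
    {u v : Fin n → ℂ} (hu : ‖u‖ ≤ c) (hv : ‖v‖ ≤ c) :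
    ‖A.toBlocks₁₁ *ᵥ u + A.toBlocks₁₂ *ᵥ v‖ ≤ ‖A‖ * c := by
  have hc : 0 ≤ c := (norm_nonneg u).trans hu
  have hw : ‖Sum.elim u v‖ ≤ c := by
    rw [pi_norm_le_iff_of_nonneg hc]
    rintro (i | i)
    · exact (norm_le_pi_norm u i).trans hu
    · exact (norm_le_pi_norm v i).trans hv
  have h := (Matrix.linfty_opNorm_mulVec A (Sum.elim u v)).trans
    (mul_le_mul_of_nonneg_left hw (norm_nonneg A))
  refine le_trans ?_ h
  rw [pi_norm_le_iff_of_nonneg (norm_nonneg _)]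
  intro i
  refine le_of_eq_of_le ?_ (norm_le_pi_norm _ (Sum.inl i))
  congr 1
  conv_rhs => rw [← Matrix.fromBlocks_toBlocks A, Matrix.fromBlocks_mulVec]
  rfl

/-! ### The fixed-point map and its link to solutions. -/

/-- The map whose fixed points `x` give the solutions `V⋆ / (1 + x)`. -/
noncomputable def fixedPointMap {n : ℕ} (Y : Matrix (Fin n) (Fin n) ℂ) (Vs ss s x : Fin n → ℂ) : Fin n → ℂ :=
  -((Mmat Y Vs ss * conjMat (Zmat Y Vs)) *ᵥ star (s - ss)
      + (Nmat Y Vs ss * Zmat Y Vs) *ᵥ (s - ss)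
    + (Mmat Y Vs ss * conjMat (Zmat Y Vs) * Matrix.diagonal (star (s - ss))
      + Nmat Y Vs ss * Matrix.diagonal (Zmat Y Vs *ᵥ (s - ss))) *ᵥ star x
    + (Mmat Y Vs ss * Matrix.diagonal (star (Zmat Y Vs *ᵥ (s - ss)))
      + Nmat Y Vs ss * Zmat Y Vs * Matrix.diagonal (s - ss)) *ᵥ x
    + (Mmat Y Vs ss *ᵥ star (star x * ((Zmat Y Vs * Matrix.diagonal s) *ᵥ x))
      + Nmat Y Vs ss *ᵥ (star x * ((Zmat Y Vs * Matrix.diagonal s) *ᵥ x))))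

/-- The right-hand side `g(x)` of `conj x + Z⋆ diag(s⋆) x = g(x)`. -/
noncomputable def residual {n : ℕ} (Y : Matrix (Fin n) (Fin n) ℂ) (Vs ss s x : Fin n → ℂ) : Fin n → ℂ :=
  -(Zmat Y Vs *ᵥ (s - ss) + (Zmat Y Vs *ᵥ (s - ss)) * star x
    + Zmat Y Vs *ᵥ ((s - ss) * x) + star x * (Zmat Y Vs *ᵥ (s * x)))

/-- The definition groups terms by their dependence on `x`, as the norm estimates need; this form
serves the algebra with `J⋆`. -/
theorem fixedPointMap_eq {n : ℕ} (Y : Matrix (Fin n) (Fin n) ℂ) (Vs ss s x : Fin n → ℂ) :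
    fixedPointMap Y Vs ss s x = Mmat Y Vs ss *ᵥ star (residual Y Vs ss s x)
      + Nmat Y Vs ss *ᵥ residual Y Vs ss s x := by
  simp only [fixedPointMap, residual, star_neg, star_add, star_mul', star_star,
    star_mulVec_eq_conjMat, Matrix.mulVec_neg, Matrix.mulVec_add, Matrix.add_mulVec,
    ← Matrix.mulVec_mulVec, diagonal_mulVec_eq_mul]
  abel

/-- The system is invariant under swapping and conjugating the two halves, so `(conj y, conj x)`
also solves it; nonsingularity of `J⋆` gives uniqueness. -/
theorem star_eq_of_Jmat_mulVec {n : ℕ} {Y : Matrix (Fin n) (Fin n) ℂ} {Vs ss g x y : Fin n → ℂ}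
    (hJ : IsUnit (Jmat Y Vs ss).det)
    (h : Jmat Y Vs ss *ᵥ Sum.elim x y = Sum.elim (star g) g) : y = star x := by
  have h1 : x + conjMat (Zmat Y Vs) *ᵥ (star ss * y) = star g ∧
      Zmat Y Vs *ᵥ (ss * x) + y = g := by
    rw [Jmat, Matrix.fromBlocks_mulVec] at h
    simp only [Matrix.one_mulVec, ← Matrix.mulVec_mulVec, diagonal_mulVec_eq_mul,
      Sum.elim_comp_inl, Sum.elim_comp_inr] at h
    exact ⟨funext fun i => congrFun h (Sum.inl i), funext fun i => congrFun h (Sum.inr i)⟩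
  have h2 : Jmat Y Vs ss *ᵥ Sum.elim (star y) (star x) = Sum.elim (star g) g := by
    rw [Jmat, Matrix.fromBlocks_mulVec]
    congr 1
    · simp only [Matrix.one_mulVec, ← Matrix.mulVec_mulVec, diagonal_mulVec_eq_mul, ← h1.2,
        star_add, star_mulVec_eq_conjMat, star_mul', Sum.elim_comp_inl, Sum.elim_comp_inr]
      abel
    · have := congrArg star h1.1
      simp only [star_add, star_mulVec_eq_conjMat, star_mul', star_star, conjMat_conjMat] at this
      simp only [Matrix.one_mulVec, ← Matrix.mulVec_mulVec, diagonal_mulVec_eq_mul, ← this,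
        Sum.elim_comp_inl, Sum.elim_comp_inr]
      abel
  have h3 := Matrix.mulVec_injective_of_isUnit ((Matrix.isUnit_iff_isUnit_det _).2 hJ)
    (h.trans h2.symm)
  exact funext fun i => congrFun h3 (Sum.inr i)

/-- A fixed point only identifies the upper half of `J⋆⁻¹ (conj g, g)` as `x`. By symmetry the lower
half is `conj x`, and the second block row of `J⋆` is the claim. -/
theorem star_add_mulVec_eq_residual {n : ℕ} {Y : Matrix (Fin n) (Fin n) ℂ} {Vs ss s x : Fin n → ℂ}
    (hJ : IsUnit (Jmat Y Vs ss).det) (hx : fixedPointMap Y Vs ss s x = x) :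
    Zmat Y Vs *ᵥ (ss * x) + star x = residual Y Vs ss s x := by
  rw [fixedPointMap_eq] at hx
  set g := residual Y Vs ss s x
  set y : Fin n → ℂ := ((Jmat Y Vs ss)⁻¹).toBlocks₂₁ *ᵥ star g + ((Jmat Y Vs ss)⁻¹).toBlocks₂₂ *ᵥ g
  have h1 : (Jmat Y Vs ss)⁻¹ *ᵥ Sum.elim (star g) g = Sum.elim x y := by
    rw [← Matrix.fromBlocks_toBlocks (Jmat Y Vs ss)⁻¹, Matrix.fromBlocks_mulVec]
    simp only [Sum.elim_comp_inl, Sum.elim_comp_inr]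
    exact congrArg (Sum.elim · y) hx
  have h2 : Jmat Y Vs ss *ᵥ Sum.elim x y = Sum.elim (star g) g := by
    rw [← h1, Matrix.mulVec_mulVec, Matrix.mul_nonsing_inv _ hJ, Matrix.one_mulVec]
  rw [star_eq_of_Jmat_mulVec hJ h2, Jmat, Matrix.fromBlocks_mulVec] at h2
  have h3 : _ = g := funext fun i => congrFun h2 (Sum.inr i)
  rw [← h3]
  ext i
  simp [← Matrix.mulVec_mulVec, diagonal_mulVec_eq_mul]

theorem isSolution_of_fixedPointMap_eq {n : ℕ} {Y : Matrix (Fin n) (Fin n) ℂ}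
    {V0 Vs ss s x : Fin n → ℂ} (hY : IsUnit Y.det) (hVs : ∀ i, Vs i ≠ 0)
    (hsol : IsSolution Y V0 ss Vs) (hJ : IsUnit (Jmat Y Vs ss).det)
    (hx : fixedPointMap Y Vs ss s x = x) :
    (∀ i, 1 + x i ≠ 0) ∧ IsSolution Y V0 s (Vs / (1 + x)) := by
  apply isSolution_div_of_eq_one hY hVs hsol
  have h := star_add_mulVec_eq_residual hJ hx
  have e : s * (1 + x) - ss = (s - ss) + s * x := by ring
  have e' : Zmat Y Vs *ᵥ (ss * x) = Zmat Y Vs *ᵥ (s * x) - Zmat Y Vs *ᵥ ((s - ss) * x) := by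
    rw [← Matrix.mulVec_sub]
    congr 1
    ring
  rw [residual, e'] at h
  rw [e, Matrix.mulVec_add]
  linear_combination h

/-! ### Bounds for the map, and existence of solutions. -/

theorem norm_fixedPointMap_sub_le {n : ℕ} (Y : Matrix (Fin n) (Fin n) ℂ) (Vs ss s : Fin n → ℂ)
    {ρ : ℝ} {x y : Fin n → ℂ} (hx : ‖x‖ ≤ ρ) (hy : ‖y‖ ≤ ρ) :
    ‖fixedPointMap Y Vs ss s x - fixedPointMap Y Vs ss s y‖ ≤
      (linNormA Y Vs ss (s - ss) + linNormB Y Vs ss (s - ss) + 2 * quadCoeff Y Vs ss s * ρ)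
        * ‖x - y‖ := by
  set K := Zmat Y Vs * Matrix.diagonal s with hK
  set A := Mmat Y Vs ss * conjMat (Zmat Y Vs) * Matrix.diagonal (star (s - ss))
      + Nmat Y Vs ss * Matrix.diagonal (Zmat Y Vs *ᵥ (s - ss)) with hA
  set B := Mmat Y Vs ss * Matrix.diagonal (star (Zmat Y Vs *ᵥ (s - ss)))
      + Nmat Y Vs ss * Zmat Y Vs * Matrix.diagonal (s - ss) with hB
  set v := star x * (K *ᵥ x) - star y * (K *ᵥ y) with hv
  have hvn : ‖v‖ ≤ 2 * ‖K‖ * ρ * ‖x - y‖ :=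
    norm_mul_mulVec_sub_le K (by rwa [norm_star]) hy (by rw [← star_sub, norm_star])
  have e : fixedPointMap Y Vs ss s x - fixedPointMap Y Vs ss s y =
      -(A *ᵥ star (x - y) + B *ᵥ (x - y) + (Mmat Y Vs ss *ᵥ star v + Nmat Y Vs ss *ᵥ v)) := by
    rw [fixedPointMap, fixedPointMap, ← hK, ← hA, ← hB]
    simp only [hv, star_sub, Matrix.mulVec_sub]
    abel
  have h3 : ‖Mmat Y Vs ss *ᵥ star v + Nmat Y Vs ss *ᵥ v‖ ≤
      ‖(Jmat Y Vs ss)⁻¹‖ * (2 * ‖K‖ * ρ * ‖x - y‖) :=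
    norm_toBlocks_mulVec_add_le _ (by rwa [norm_star]) hvn
  have h1 : ‖A *ᵥ star (x - y)‖ ≤ ‖A‖ * ‖x - y‖ := by
    simpa only [norm_star] using Matrix.linfty_opNorm_mulVec A (star (x - y))
  have h2 : ‖B *ᵥ (x - y)‖ ≤ ‖B‖ * ‖x - y‖ := Matrix.linfty_opNorm_mulVec B (x - y)
  rw [e, norm_neg]
  refine (norm_add₃_le.trans (add_le_add (add_le_add h1 h2) h3)).trans_eq ?_
  simp only [linNormA, linNormB, quadCoeff, ← hK, ← hA, ← hB]
  ring

theorem norm_fixedPointMap_le {n : ℕ} (Y : Matrix (Fin n) (Fin n) ℂ) (Vs ss s : Fin n → ℂ)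
    {ρ : ℝ} {x : Fin n → ℂ} (hx : ‖x‖ ≤ ρ) :
    ‖fixedPointMap Y Vs ss s x‖ ≤ shiftVecNorm Y Vs ss (s - ss) + quadCoeff Y Vs ss s * ρ ^ 2
      + (linNormA Y Vs ss (s - ss) + linNormB Y Vs ss (s - ss)) * ρ := by
  set K := Zmat Y Vs * Matrix.diagonal s with hK
  set A := Mmat Y Vs ss * conjMat (Zmat Y Vs) * Matrix.diagonal (star (s - ss))
      + Nmat Y Vs ss * Matrix.diagonal (Zmat Y Vs *ᵥ (s - ss)) with hA
  set B := Mmat Y Vs ss * Matrix.diagonal (star (Zmat Y Vs *ᵥ (s - ss)))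
      + Nmat Y Vs ss * Zmat Y Vs * Matrix.diagonal (s - ss) with hB
  have hρ : 0 ≤ ρ := (norm_nonneg x).trans hx
  set v := star x * (K *ᵥ x) with hv
  have hvn : ‖v‖ ≤ ρ * (‖K‖ * ρ) := by
    refine (norm_mul_le _ _).trans ?_
    rw [norm_star]
    have := Matrix.linfty_opNorm_mulVec K x
    gcongr
    exact this.trans (by gcongr)
  have h3 : ‖Mmat Y Vs ss *ᵥ star v + Nmat Y Vs ss *ᵥ v‖ ≤
      ‖(Jmat Y Vs ss)⁻¹‖ * (ρ * (‖K‖ * ρ)) :=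
    norm_toBlocks_mulVec_add_le _ (by rwa [norm_star]) hvn
  have h1 : ‖A *ᵥ star x‖ ≤ ‖A‖ * ρ := by
    refine (Matrix.linfty_opNorm_mulVec A (star x)).trans ?_
    rw [norm_star]
    gcongr
  have h2 : ‖B *ᵥ x‖ ≤ ‖B‖ * ρ := (Matrix.linfty_opNorm_mulVec B x).trans (by gcongr)
  rw [fixedPointMap, norm_neg]
  refine ((norm_add_le _ _).trans (add_le_add (norm_add₃_le.trans
    (add_le_add (add_le_add le_rfl h1) h2)) h3)).trans_eq ?_
  simp only [shiftVecNorm, linNormA, linNormB, quadCoeff, ← hK, ← hA, ← hB]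
  ring

theorem exists_isSolution_of_radius {n : ℕ} {Y : Matrix (Fin n) (Fin n) ℂ}
    {V0 Vs ss s : Fin n → ℂ} (hY : IsUnit Y.det) (hVs : ∀ i, Vs i ≠ 0)
    (hsol : IsSolution Y V0 ss Vs) (hJ : IsUnit (Jmat Y Vs ss).det) {ρ : ℝ} (hρ : 0 ≤ ρ)
    (hmaps : shiftVecNorm Y Vs ss (s - ss) + quadCoeff Y Vs ss s * ρ ^ 2
      + (linNormA Y Vs ss (s - ss) + linNormB Y Vs ss (s - ss)) * ρ ≤ ρ)
    (hlip : linNormA Y Vs ss (s - ss) + linNormB Y Vs ss (s - ss)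
      + 2 * quadCoeff Y Vs ss s * ρ ≤ 1) :
    ∃ x : Fin n → ℂ, ‖x‖ ≤ ρ ∧ (∀ i, 1 + x i ≠ 0) ∧ IsSolution Y V0 s (Vs / (1 + x)) := by
  obtain ⟨x, hx, hfix⟩ := exists_fixedPoint_of_nonexpansive_closedBall
    (T := fixedPointMap Y Vs ss s) hρ
    (fun x hx => mem_closedBall_zero_iff.2
      ((norm_fixedPointMap_le Y Vs ss s (mem_closedBall_zero_iff.1 hx)).trans hmaps))
    (LipschitzOnWith.of_dist_le_mul fun x hx y hy => by
      rw [dist_eq_norm, dist_eq_norm, NNReal.coe_one]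
      exact (norm_fixedPointMap_sub_le Y Vs ss s (mem_closedBall_zero_iff.1 hx)
        (mem_closedBall_zero_iff.1 hy)).trans
        (mul_le_mul_of_nonneg_right hlip (norm_nonneg _)))
  exact ⟨x, mem_closedBall_zero_iff.1 hx, isSolution_of_fixedPointMap_eq hY hVs hsol hJ hfix⟩

theorem voltageBounds_div {n : ℕ} {Vs x : Fin n → ℂ} {r : ℝ} (hx : ‖x‖ ≤ r)
    (hne : ∀ i, 1 + x i ≠ 0) (hr : r < 1) : VoltageBounds Vs r (Vs / (1 + x)) := by
  intro i
  have hi : ‖x i‖ ≤ r := (norm_le_pi_norm x i).trans hx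
  have hpos : 0 < ‖1 + x i‖ := norm_pos_iff.2 (hne i)
  have h1 : ‖1 + x i‖ ≤ 1 + r := by
    have := norm_add_le 1 (x i)
    rw [norm_one] at this
    linarith
  have h2 : 1 - r ≤ ‖1 + x i‖ := by
    have := norm_sub_le (1 + x i) (x i)
    rw [add_sub_cancel_right, norm_one] at this
    linarith
  have hr' : 0 < 1 - r := by linarith
  simp only [Pi.div_apply, Pi.add_apply, Pi.one_apply, norm_div]
  constructor <;> gcongr

theorem shiftVecNorm_le_shiftMatNorm {n : ℕ} (Y : Matrix (Fin n) (Fin n) ℂ)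
    (Vs ss d : Fin n → ℂ) : shiftVecNorm Y Vs ss d ≤ shiftMatNorm Y Vs ss d := by
  unfold shiftVecNorm shiftMatNorm
  set A := Mmat Y Vs ss * conjMat (Zmat Y Vs)
  set B := Nmat Y Vs ss * Zmat Y Vs
  have e : A *ᵥ star d + B *ᵥ d =
      (A * Matrix.diagonal (star d) + B * Matrix.diagonal d) *ᵥ (1 : Fin n → ℂ) := by
    simp only [Matrix.add_mulVec, ← Matrix.mulVec_mulVec, diagonal_mulVec_eq_mul, mul_one]
  -- Only an inequality: the norm is 0 when `n = 0`.
  have h1 : ‖(1 : Fin n → ℂ)‖ ≤ 1 := by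
    rw [pi_norm_le_iff_of_nonneg zero_le_one]
    simp
  rw [e]
  exact (Matrix.linfty_opNorm_mulVec _ _).trans (mul_le_of_le_one_right (norm_nonneg _) h1)

theorem quadCoeff_nonneg {n : ℕ} (Y : Matrix (Fin n) (Fin n) ℂ) (Vs ss s : Fin n → ℂ) :
    0 ≤ quadCoeff Y Vs ss s :=
  mul_nonneg (norm_nonneg _) (norm_nonneg _)

/-- Covers the case in which the radius `√(c / q)` is unavailable. -/
theorem eq_zero_of_quadCoeff_eq_zero {n : ℕ} {Y : Matrix (Fin n) (Fin n) ℂ} {Vs ss s : Fin n → ℂ}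
    (hY : IsUnit Y.det) (hVs : ∀ i, Vs i ≠ 0) (hJ : IsUnit (Jmat Y Vs ss).det)
    (h : quadCoeff Y Vs ss s = 0) : s = 0 := by
  rcases mul_eq_zero.1 h with h | h
  -- `J⋆⁻¹ = 0` would make a diagonal entry of the identity zero, so no index `i` exists.
  · have h1 := Matrix.mul_nonsing_inv _ hJ
    rw [norm_eq_zero.1 h, mul_zero] at h1
    ext i
    simpa using congrFun (congrFun h1 (Sum.inl i)) (Sum.inl i)
  -- Since `Z⋆ diag(s) = 0`, applying it to the all-ones vector gives `s / V⋆ = 0`.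
  · have h1 := conjMat_mulVec_Zmat hY hVs (s * 1)
    rw [← diagonal_mulVec_eq_mul s, Matrix.mulVec_mulVec, norm_eq_zero.1 h, Matrix.zero_mulVec,
      mul_zero, Matrix.mulVec_zero, diagonal_mulVec_eq_mul, mul_one] at h1
    ext i
    have := congrFun h1 i
    simpa [hVs i] using this.symm

end PowerFlow

theorem mainTheorem2 (n : ℕ) (Y : Matrix (Fin n) (Fin n) ℂ) (V0 Vs ss : Fin n → ℂ)
    (hY : IsUnit Y.det) (hVs : ∀ i, Vs i ≠ 0)
    (hsol : PowerFlow.IsSolution Y V0 ss Vs)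
    (hJ : IsUnit (PowerFlow.Jmat Y Vs ss).det) :
    (∀ r : ℝ, 0 < r → ∀ s ∈ PowerFlow.certUnion Y Vs ss r,
      ∃ V : Fin n → ℂ, PowerFlow.IsSolution Y V0 s V ∧
        (r < 1 → PowerFlow.VoltageBounds Vs r V)) ∧
    (∀ s : Fin n → ℂ, PowerFlow.RadiusFreeCondition Y Vs ss s →
      ∃ V : Fin n → ℂ, PowerFlow.IsSolution Y V0 s V) := by
  constructor
  · intro r hr s hs
    simp only [PowerFlow.certUnion, Set.mem_iUnion] at hs
    obtain ⟨ε, ⟨hε0, hε1⟩, hs⟩ := hs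
    obtain ⟨ρ, hρ0, hρr, hmaps, hlip⟩ := exists_radius_le_vertex
      (c := PowerFlow.shiftVecNorm Y Vs ss (s - ss))
      (l := PowerFlow.linNormA Y Vs ss (s - ss) + PowerFlow.linNormB Y Vs ss (s - ss))
      (norm_nonneg _) (PowerFlow.quadCoeff_nonneg Y Vs ss s)
      (mul_pos hε0 hr) ((add_assoc _ _ _).symm.trans_le hs)
    obtain ⟨x, hx, hne, hV⟩ :=
      PowerFlow.exists_isSolution_of_radius hY hVs hsol hJ hρ0 hmaps hlip
    have hxr : ‖x‖ ≤ r := (hx.trans hρr).trans (mul_le_of_le_one_left hr.le hε1)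
    exact ⟨_, hV, fun hr1 => PowerFlow.voltageBounds_div hxr hne hr1⟩
  · intro s hs
    rcases (PowerFlow.quadCoeff_nonneg Y Vs ss s).eq_or_lt with hq | hq
    -- With `s = 0` the zero-current voltage `V⁰` is a solution.
    · refine ⟨V0, ?_⟩
      rw [PowerFlow.eq_zero_of_quadCoeff_eq_zero hY hVs hJ hq.symm]
      simp [PowerFlow.IsSolution]
    · have hle := PowerFlow.shiftVecNorm_le_shiftMatNorm Y Vs ss (s - ss)
      obtain ⟨ρ, hρ0, hmaps, hlip⟩ := exists_radius_of_discriminant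
        (c := PowerFlow.shiftMatNorm Y Vs ss (s - ss))
        (l := PowerFlow.linNormA Y Vs ss (s - ss) + PowerFlow.linNormB Y Vs ss (s - ss))
        ((norm_nonneg _).trans hle) hq ((add_assoc _ _ _).symm.trans_le hs)
      obtain ⟨x, -, -, hV⟩ :=
        PowerFlow.exists_isSolution_of_radius hY hVs hsol hJ hρ0 (by linarith) hlip
      exact ⟨_, hV⟩
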